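/- Let $N\ge 1$ be an odd integer, $X(N)=\Gamma(N)\backslash(\mathbb H\cup\mathbf P^1(\mathbf Q))$ the compactified modular curve and $\partial_N=\Gamma(N)\backslash\mathbf P^1(\mathbf Q)$ its set of cusps. For $g\in \mathrm{SL}_2(\mathbf Z)$ let $\xi(g)\in H_1(X(N),\partial_N;\mathbf R)$ be the class of the image in $X(N)$ of the geodesic from $g0$ to $g\infty$; it depends only on the class of $g$ in $\overline{\mathrm{SL}_2(\mathbf Z/N\mathbf Z)}=\mathrm{SL}_2(\mathbf Z/N\mathbf Z)/\{\pm1\}=\pm\Gamma(N)\backslash \mathrm{SL}_2(\mathbf Z)$. For a column vector $P=(\bar x,\bar y)\in(\mathbf Z/N\mathbf Z)^2$ choose integers $x,y$ representing $\bar x,\bar y$ with $x-y$ odd and put $$F(P)=-\frac14\cdot\frac{\cos(\pi x/N)+\cos(\pi y/N)}{\cos(\pi x/N)-\cos(\pi y/N)},$$ which does not depend on the choice and satisfies $F(-P)=F(P)$. Let $$\mathcal E_P=\sum_{\gamma\in\overline{\mathrm{SL}_2(\mathbf Z/N\mathbf Z)}}F(\gamma^{-1}P)\,\xi(\gamma)\in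 H_1(X(N),\partial_N;\mathbf R).$$ Let $\delta:H_1(X(N),\partial_N;\mathbf R)\to\mathbf R[\partial_N]$ be the boundary map, which sends the class of a path from the cusp $r$ to the cusp $s$ to $(s)-(r)$. Let $C_N$ be the set of elements of order $N$ in $(\mathbf Z/N\mathbf Z)^2$ modulo $\pm1$; write $(Q)$ for the basis element of $\mathbf R[C_N]$ given by the class of $Q$, and let $P_\infty=(1,0)$. Then the map $\partial_N\to C_N$, which sends the class of $u/v$ ($u,v$ coprime integers) to the class of $(u,v)$, is a bijection. With $\partial_N$ identified with $C_N$ by this map, for every $P\in(\mathbf Z/N\mathbf Z)^2$ of order $N$, $$\delta(\mathcal E_P)=2N\sum_{\mu\in(\mathbf Z/N\mathbf Z)^*/\{\pm1\}}\Bigl(F(\mu P_\infty)+\tfrac14\Bigr)(\mu^{-1}P)-\frac N2\sum_{Q\in C_N}(Q)$$ in $\mathbf R[C_N]$. -/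

import Mathlib

open scoped MatrixGroups UpperHalfPlane
open CongruenceSubgroup

noncomputable section

namespace EisensteinCycle

/-! ### Singular homology of a pair in degree one -/

/-- Singular `n`-chains of `X` with coefficients in `R`. -/
abbrev Chain (R X : Type*) [CommRing R] [TopologicalSpace X] (n : ℕ) : Type _ :=
  C(stdSimplex ℝ (Fin (n + 1)), X) →₀ R

/-- The `i`-th face inclusion of standard simplices, omitting the `i`-th vertex. -/
def face (n : ℕ) (i : Fin (n + 2)) :
    C(stdSimplex ℝ (Fin (n + 1)), stdSimplex ℝ (Fin (n + 2))) :=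
  ⟨stdSimplex.map i.succAbove, stdSimplex.continuous_map _⟩

section Pair

variable (R : Type*) {X : Type*} [CommRing R] [TopologicalSpace X]

/-- The singular boundary operator `∂σ = ∑ i, (-1) ^ i σ ∘ dⁱ`. -/
def bdry (n : ℕ) : Chain R X (n + 1) →ₗ[R] Chain R X n :=
  Finsupp.linearCombination R fun σ : C(stdSimplex ℝ (Fin (n + 2)), X) =>
    ∑ i : Fin (n + 2), (-1 : R) ^ (i : ℕ) • Finsupp.single (σ.comp (face n i)) (1 : R)

/-- The submodule of singular `n`-chains of the subspace `A`. -/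
def chainsIn (A : Set X) (n : ℕ) : Submodule R (Chain R X n) :=
  Finsupp.supported R R {σ | ∀ t, σ t ∈ A}

/-- Relative one-cycles: one-chains of `X` whose boundary is a chain of `A`. -/
def relCycles (A : Set X) : Submodule R (Chain R X 1) :=
  (chainsIn R A 0).comap (bdry R 0)

/-- Relative one-boundaries: boundaries of two-chains of `X` plus one-chains of `A`. -/
def relBoundaries (A : Set X) : Submodule R (Chain R X 1) :=
  LinearMap.range (bdry R (X := X) 1) ⊔ chainsIn R A 1

instance (A : Set X) : AddCommGroup (relCycles R A) := (relCycles R A).addCommGroup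

/-- The relative singular homology group `H₁(X, A; R)`. -/
abbrev RelH1 (A : Set X) : Type _ :=
  relCycles R A ⧸ (relBoundaries R A).comap (relCycles R A).subtype

/-- A zero-chain of `X`, as a formal combination of points of `X`. -/
def pointsOf : Chain R X 0 →ₗ[R] (X →₀ R) :=
  Finsupp.lmapDomain R R fun σ : C(stdSimplex ℝ (Fin 1), X) => σ default

lemma bdry_single (n : ℕ) (σ : C(stdSimplex ℝ (Fin (n + 2)), X)) :
    bdry R n (Finsupp.single σ 1) =
      ∑ i : Fin (n + 2), (-1 : R) ^ (i : ℕ) • Finsupp.single (σ.comp (face n i)) (1 : R) := by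
  simp [bdry]

lemma face_default (i : Fin 2) :
    face 0 i default = stdSimplex.vertex (S := ℝ) (i.succAbove (0 : Fin 1)) := by
  have h : (default : stdSimplex ℝ (Fin 1)) = stdSimplex.vertex 0 := Subsingleton.elim _ _
  rw [h]
  exact stdSimplex.map_vertex _ _

lemma pointsOf_bdry_single (σ : C(stdSimplex ℝ (Fin 2), X)) :
    pointsOf R (bdry R 0 (Finsupp.single σ 1)) =
      Finsupp.single (σ (stdSimplex.vertex 1)) 1 - Finsupp.single (σ (stdSimplex.vertex 0)) 1 := by
  have h0 : (0 : Fin 2).succAbove (0 : Fin 1) = 1 := rfl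
  have h1 : (1 : Fin 2).succAbove (0 : Fin 1) = 0 := rfl
  rw [bdry_single]
  erw [Fin.sum_univ_two]
  rw [map_add, map_smul, map_smul, pointsOf, Finsupp.lmapDomain_apply, Finsupp.lmapDomain_apply,
    Finsupp.mapDomain_single, Finsupp.mapDomain_single, ContinuousMap.comp_apply,
    ContinuousMap.comp_apply, face_default, face_default, h0, h1]
  simp [sub_eq_add_neg]

lemma pointsOf_bdry_bdry (c : Chain R X 2) : pointsOf R (bdry R 0 (bdry R 1 c)) = 0 := by
  suffices h : (pointsOf R ∘ₗ bdry R 0 ∘ₗ bdry R (X := X) 1) = 0 from LinearMap.congr_fun h c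
  ext1 σ
  ext1
  have hv : ∀ (i : Fin 3) (j : Fin 2), face 1 i (stdSimplex.vertex (S := ℝ) j) =
      stdSimplex.vertex (i.succAbove j) := fun i j => stdSimplex.map_vertex _ _
  have e : ∀ i : Fin 3, pointsOf R (bdry R 0 (Finsupp.single (σ.comp (face 1 i)) (1 : R))) =
      Finsupp.single (σ (stdSimplex.vertex (i.succAbove 1))) 1 -
        Finsupp.single (σ (stdSimplex.vertex (i.succAbove 0))) 1 := fun i => by
    rw [pointsOf_bdry_single]
    simp only [ContinuousMap.comp_apply, hv]
  simp only [LinearMap.comp_apply, Finsupp.lsingle_apply, bdry_single R 1, map_sum, map_smul, e,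
    LinearMap.zero_apply]
  erw [Fin.sum_univ_three]
  have h00 : (0 : Fin 3).succAbove (0 : Fin 2) = 1 := rfl
  have h01 : (0 : Fin 3).succAbove (1 : Fin 2) = 2 := rfl
  have h10 : (1 : Fin 3).succAbove (0 : Fin 2) = 0 := rfl
  have h11 : (1 : Fin 3).succAbove (1 : Fin 2) = 2 := rfl
  have h20 : (2 : Fin 3).succAbove (0 : Fin 2) = 0 := rfl
  have h21 : (2 : Fin 3).succAbove (1 : Fin 2) = 1 := rfl
  rw [h00, h01, h10, h11, h20, h21]
  simp

/-- The boundary of a relative one-cycle, as a formal combination of points of `A`. -/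
def cycleBoundary (A : Set X) : relCycles R A →ₗ[R] (A →₀ R) :=
  Finsupp.lsubtypeDomain A ∘ₗ pointsOf R ∘ₗ bdry R 0 ∘ₗ (relCycles R A).subtype

lemma cycleBoundary_eq_zero (A : Set X) [TotallyDisconnectedSpace A] :
    (relBoundaries R A).comap (relCycles R A).subtype ≤ LinearMap.ker (cycleBoundary R A) := by
  have key : relBoundaries R A ≤ LinearMap.ker (pointsOf R ∘ₗ bdry R (X := X) 0) := by
    refine sup_le ?_ ?_
    · rintro _ ⟨c, rfl⟩
      exact pointsOf_bdry_bdry R c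
    · rw [chainsIn, Finsupp.supported_eq_span_single, Submodule.span_le]
      rintro _ ⟨σ, hσ, rfl⟩
      have hc : Continuous fun t => (⟨σ t, hσ t⟩ : A) := σ.continuous.subtype_mk _
      have heq := (isPreconnected_univ.image _ hc.continuousOn).subsingleton
        (Set.mem_image_of_mem _ (Set.mem_univ (stdSimplex.vertex (S := ℝ) (1 : Fin 2))))
        (Set.mem_image_of_mem _ (Set.mem_univ (stdSimplex.vertex (S := ℝ) (0 : Fin 2))))
      have heq' := congrArg Subtype.val heq
      simp only at heq'
      simp only [SetLike.mem_coe, LinearMap.mem_ker, LinearMap.comp_apply, pointsOf_bdry_single]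
      rw [heq', sub_self]
  intro c hc
  have h0 : pointsOf R (bdry R 0 (c : Chain R X 1)) = 0 := key hc
  simp only [LinearMap.mem_ker, cycleBoundary, LinearMap.comp_apply, Submodule.subtype_apply, h0,
    map_zero]

/-- The connecting homomorphism `H₁(X, A; R) → H₀(A; R) = R[A]` for a totally disconnected
subspace `A`. The class of a path from `r` to `s` goes to `(s) - (r)`. -/
def connecting (A : Set X) [TotallyDisconnectedSpace A] : RelH1 R A →ₗ[R] (A →₀ R) :=
  Submodule.liftQ _ (cycleBoundary R A) (cycleBoundary_eq_zero R A)

/-- The class in `H₁(X, A; R)` of a path (a singular one-simplex) with end points in `A`. -/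
def pathClass {A : Set X} (σ : C(stdSimplex ℝ (Fin 2), X)) (h0 : σ (stdSimplex.vertex 0) ∈ A)
    (h1 : σ (stdSimplex.vertex 1) ∈ A) : RelH1 R A :=
  Submodule.Quotient.mk ⟨Finsupp.single σ 1, by
    have hm : ∀ i : Fin 2, Finsupp.single (σ.comp (face 0 i)) (1 : R) ∈ chainsIn R A 0 := fun i =>
      Finsupp.single_mem_supported _ _ fun t => by
        rw [Subsingleton.elim t default, ContinuousMap.comp_apply, face_default]
        fin_cases i
        · exact h1
        · exact h0
    rw [relCycles, Submodule.mem_comap, bdry_single]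
    exact Submodule.sum_mem _ fun i _ => Submodule.smul_mem _ _ (hm i)⟩

end Pair

/-! ### The extended upper half-plane and the modular curve `X(N)` -/

/-- The extended upper half-plane `ℍ ∪ ℙ¹(ℚ)`. -/
inductive ExtUpperHalfPlane : Type
  | point : ℍ → ExtUpperHalfPlane
  | cusp : OnePoint ℚ → ExtUpperHalfPlane

open ExtUpperHalfPlane OnePoint Matrix.SpecialLinearGroup

/-- The action of `SL₂(ℤ)` on `ℙ¹(ℚ)` by homographies. -/
instance : MulAction SL(2, ℤ) (OnePoint ℚ) := MulAction.compHom _ (mapGL ℚ)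

lemma mapGL_apply (g : SL(2, ℤ)) (i j : Fin 2) : mapGL ℚ g i j = (g i j : ℚ) := rfl

lemma smul_cusp_def (g : SL(2, ℤ)) (c : OnePoint ℚ) : g • c = mapGL ℚ g • c := rfl

/-- The action of `SL₂(ℤ)` on the extended upper half-plane by homographies. -/
instance : MulAction SL(2, ℤ) ExtUpperHalfPlane where
  smul g z := match z with
    | point τ => point (g • τ)
    | cusp c => cusp (g • c)
  one_smul z := by
    cases z
    · exact congrArg point (one_smul _ _)
    · exact congrArg cusp (one_smul _ _)
  mul_smul g h z := by
    cases z
    · exact congrArg point (mul_smul _ _ _)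
    · exact congrArg cusp (mul_smul _ _ _)

lemma smul_point (g : SL(2, ℤ)) (τ : ℍ) : g • point τ = point (g • τ) := rfl

lemma smul_cusp (g : SL(2, ℤ)) (c : OnePoint ℚ) : g • cusp c = cusp (g • c) := rfl

/-- The horoball topology: a set is open when its trace on `ℍ` is open and it contains, for each
of its cusps `g ∞`, the image under `g` of some half-plane `{τ | A < Im τ}`. -/
instance : TopologicalSpace ExtUpperHalfPlane where
  IsOpen U := IsOpen (point ⁻¹' U) ∧
    ∀ g : SL(2, ℤ), cusp (g • ∞) ∈ U → ∃ A : ℝ, ∀ τ : ℍ, A < τ.im → point (g • τ) ∈ U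
  isOpen_univ := ⟨isOpen_univ, fun _ _ => ⟨0, fun _ _ => trivial⟩⟩
  isOpen_inter U V hU hV := ⟨hU.1.inter hV.1, fun g hg => by
    obtain ⟨A, hA⟩ := hU.2 g hg.1
    obtain ⟨B, hB⟩ := hV.2 g hg.2
    exact ⟨max A B, fun τ hτ => ⟨hA τ ((le_max_left _ _).trans_lt hτ),
      hB τ ((le_max_right _ _).trans_lt hτ)⟩⟩⟩
  isOpen_sUnion S hS := ⟨by
    rw [Set.preimage_sUnion]
    exact isOpen_biUnion fun U hU => (hS U hU).1, fun g ⟨U, hU, hg⟩ => by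
    obtain ⟨A, hA⟩ := (hS U hU).2 g hg
    exact ⟨A, fun τ hτ => ⟨U, hU, hA τ hτ⟩⟩⟩

lemma isOpen_ext_iff {U : Set ExtUpperHalfPlane} : IsOpen U ↔ IsOpen (point ⁻¹' U) ∧
    ∀ g : SL(2, ℤ), cusp (g • ∞) ∈ U → ∃ A : ℝ, ∀ τ : ℍ, A < τ.im → point (g • τ) ∈ U :=
  Iff.rfl

lemma continuous_ext_smul (g : SL(2, ℤ)) : Continuous fun z : ExtUpperHalfPlane => g • z := by
  refine ⟨fun U hU => ?_⟩
  rw [isOpen_ext_iff] at hU ⊢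
  refine ⟨?_, fun h hh => ?_⟩
  · have hc : Continuous fun τ : ℍ => g • τ :=
      continuous_const_smul (mapGL ℝ g)
    exact hU.1.preimage hc
  · obtain ⟨A, hA⟩ := hU.2 (g * h) (by simpa [smul_cusp, mul_smul] using hh)
    exact ⟨A, fun τ hτ => by simpa [smul_point, mul_smul] using hA τ hτ⟩

/-- The compactified modular curve `X(N) = Γ(N) \ (ℍ ∪ ℙ¹(ℚ))`, with the quotient topology. -/
abbrev XCurve (N : ℕ) : Type := MulAction.orbitRel.Quotient (Gamma N) ExtUpperHalfPlane

/-- The projection `ℍ ∪ ℙ¹(ℚ) → X(N)`. -/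
def proj (N : ℕ) : C(ExtUpperHalfPlane, XCurve N) := ⟨Quotient.mk _, continuous_quotient_mk'⟩

lemma proj_eq_iff {N : ℕ} {z w : ExtUpperHalfPlane} :
    proj N z = proj N w ↔ ∃ g ∈ Gamma N, g • w = z := by
  refine Quotient.eq.trans ?_
  rw [MulAction.orbitRel_apply, MulAction.mem_orbit_iff]
  exact ⟨fun ⟨g, hg⟩ => ⟨g, g.2, hg⟩, fun ⟨g, hg, h⟩ => ⟨⟨g, hg⟩, h⟩⟩

/-- The set `∂_N` of cusps of `X(N)`. -/
def cusps (N : ℕ) : Set (XCurve N) := Set.range fun c : OnePoint ℚ => proj N (cusp c)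

lemma proj_cusp_mem (N : ℕ) (c : OnePoint ℚ) : proj N (cusp c) ∈ cusps N := ⟨c, rfl⟩

/-- The cusps of `X(N)` form a discrete subspace. -/
instance (N : ℕ) : DiscreteTopology (cusps N) := by
  refine discreteTopology_iff_isOpen_singleton.mpr ?_
  rintro ⟨x, hx⟩
  have hU : IsOpen {y : XCurve N | y = x ∨ y ∉ cusps N} := by
    refine (isQuotientMap_quotient_mk' (s := MulAction.orbitRel (Gamma N)
      ExtUpperHalfPlane)).isOpen_preimage.mp ?_
    have hpt : ∀ τ : ℍ, proj N (point τ) ∉ cusps N := by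
      rintro τ ⟨c, hc⟩
      obtain ⟨g, -, hg⟩ := proj_eq_iff.mp hc
      rw [smul_point] at hg
      exact ExtUpperHalfPlane.noConfusion hg
    have hpre : point ⁻¹' (proj N ⁻¹' {y : XCurve N | y = x ∨ y ∉ cusps N}) = Set.univ :=
      Set.eq_univ_of_forall fun τ => Or.inr (hpt τ)
    exact isOpen_ext_iff.mpr ⟨hpre ▸ isOpen_univ, fun g _ => ⟨0, fun τ _ => Or.inr (hpt _)⟩⟩
  refine ⟨_, hU, ?_⟩
  ext ⟨y, hy⟩
  simp

/-! ### Manin generators -/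

/-- The geodesic of `ℍ ∪ ℙ¹(ℚ)` from `0` to `∞`: the simplex coordinates `(t₀, t₁)` go to
`i t₁ / t₀`. -/
def geodesicFun (t : stdSimplex ℝ (Fin 2)) : ExtUpperHalfPlane :=
  if t 1 = 0 then cusp ((0 : ℚ) : OnePoint ℚ)
  else if t 0 = 0 then cusp ∞
  else point (UpperHalfPlane.ofComplex (Complex.I * ((t 1 / t 0 : ℝ) : ℂ)))


lemma S_smul_infty : ModularGroup.S • (∞ : OnePoint ℚ) = ((0 : ℚ) : OnePoint ℚ) := by
  rw [smul_cusp_def, smul_infty_eq_ite, mapGL_apply, mapGL_apply]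
  simp [ModularGroup.S]

lemma S_smul_ofComplex {y : ℝ} (hy : 0 < y) :
    ModularGroup.S • UpperHalfPlane.ofComplex (Complex.I * ((y⁻¹ : ℝ) : ℂ)) =
      UpperHalfPlane.ofComplex (Complex.I * (y : ℂ)) := by
  have h1 : 0 < (Complex.I * (y : ℂ)).im := by simpa using hy
  have h2 : 0 < (Complex.I * ((y⁻¹ : ℝ) : ℂ)).im := by simpa using hy
  rw [UpperHalfPlane.modular_S_smul, UpperHalfPlane.ofComplex_apply_of_im_pos h1,
    UpperHalfPlane.ofComplex_apply_of_im_pos h2]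
  ext
  simp [mul_comm]

lemma im_ofComplex_I_mul {y : ℝ} (hy : 0 < y) :
    (UpperHalfPlane.ofComplex (Complex.I * (y : ℂ))).im = y := by
  have h1 : 0 < (Complex.I * (y : ℂ)).im := by simpa using hy
  rw [UpperHalfPlane.ofComplex_apply_of_im_pos h1]
  simp [UpperHalfPlane.im]

lemma continuous_geodesicFun : Continuous geodesicFun := by
  have hc : ∀ i : Fin 2, Continuous fun t : stdSimplex ℝ (Fin 2) => t i := fun i =>
    (_root_.continuous_apply i).comp continuous_subtype_val
  refine ⟨fun U hU => isOpen_iff_mem_nhds.mpr fun t ht => ?_⟩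
  have hU' := isOpen_ext_iff.mp hU
  have hsum := stdSimplex.add_eq_one t
  by_cases h1 : t 1 = 0
  · have h0 : t 0 = 1 := by linarith
    have hz : cusp (ModularGroup.S • ∞) ∈ U := by
      rw [S_smul_infty]
      simpa [geodesicFun, h1] using ht
    obtain ⟨A, hA⟩ := hU'.2 _ hz
    have e1 : ∀ᶠ s in nhds t, A * s 1 < s 0 :=
      ((continuous_const.mul (hc 1)).continuousAt).eventually_lt (hc 0).continuousAt
        (by simp [h0, h1])
    have e2 : ∀ᶠ s in nhds t, 0 < s 0 :=
      continuousAt_const.eventually_lt (hc 0).continuousAt (by simp [h0])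
    filter_upwards [e1, e2] with s hs1 hs2
    by_cases h : s 1 = 0
    · rw [S_smul_infty] at hz
      simpa [geodesicFun, h] using hz
    · have hp : 0 < s 1 := lt_of_le_of_ne (stdSimplex.zero_le s 1) (Ne.symm h)
      have hq : 0 < s 1 / s 0 := div_pos hp hs2
      have := hA (UpperHalfPlane.ofComplex (Complex.I * (((s 1 / s 0)⁻¹ : ℝ) : ℂ))) (by
        rw [im_ofComplex_I_mul (inv_pos.mpr hq), inv_div, lt_div_iff₀ hp]
        exact hs1)
      rw [S_smul_ofComplex hq] at this
      simpa [geodesicFun, h, hs2.ne'] using this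
  · have hp1 : 0 < t 1 := lt_of_le_of_ne (stdSimplex.zero_le t 1) (Ne.symm h1)
    have e1 : ∀ᶠ s in nhds t, 0 < s 1 :=
      continuousAt_const.eventually_lt (hc 1).continuousAt hp1
    by_cases h0 : t 0 = 0
    · have hz : cusp ∞ ∈ U := by simpa [geodesicFun, h0, h1] using ht
      obtain ⟨A, hA⟩ := hU'.2 1 (by simpa using hz)
      have e2 : ∀ᶠ s in nhds t, A * s 0 < s 1 :=
        ((continuous_const.mul (hc 0)).continuousAt).eventually_lt (hc 1).continuousAt
          (by simpa [h0] using hp1)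
      filter_upwards [e1, e2] with s hs1 hs2
      by_cases h : s 0 = 0
      · simpa [geodesicFun, h, hs1.ne'] using hz
      · have hp : 0 < s 0 := lt_of_le_of_ne (stdSimplex.zero_le s 0) (Ne.symm h)
        have := hA (UpperHalfPlane.ofComplex (Complex.I * ((s 1 / s 0 : ℝ) : ℂ))) (by
          rw [im_ofComplex_I_mul (div_pos hs1 hp), lt_div_iff₀ hp]
          exact hs2)
        rw [one_smul] at this
        simpa [geodesicFun, h, hs1.ne'] using this
    · have hp0 : 0 < t 0 := lt_of_le_of_ne (stdSimplex.zero_le t 0) (Ne.symm h0)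
      have e0 : ∀ᶠ s in nhds t, 0 < s 0 :=
        continuousAt_const.eventually_lt (hc 0).continuousAt hp0
      have hq : ContinuousAt (fun s : stdSimplex ℝ (Fin 2) =>
          UpperHalfPlane.ofComplex (Complex.I * ((s 1 / s 0 : ℝ) : ℂ))) t :=
        ContinuousAt.comp (f := fun s : stdSimplex ℝ (Fin 2) => s 1 / s 0)
          (g := fun y : ℝ => UpperHalfPlane.ofComplex (Complex.I * (y : ℂ)))
          (UpperHalfPlane.continuousOn_ofComplex_I_mul.continuousAt
            (Ioi_mem_nhds (div_pos hp1 hp0)))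
          ((hc 1).continuousAt.div (hc 0).continuousAt h0)
      have e2 := hq.eventually_mem (hU'.1.mem_nhds (by simpa [geodesicFun, h0, h1] using ht))
      filter_upwards [e0, e1, e2] with s hs0 hs1 hs2
      simpa [geodesicFun, hs0.ne', hs1.ne'] using hs2

/-- The image in `X(N)` of the geodesic from `g 0` to `g ∞`. -/
def maninPath (N : ℕ) (g : SL(2, ℤ)) : C(stdSimplex ℝ (Fin 2), XCurve N) :=
  (proj N).comp ⟨fun t => g • geodesicFun t, (continuous_ext_smul g).comp continuous_geodesicFun⟩

lemma maninPath_zero (N : ℕ) (g : SL(2, ℤ)) :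
    maninPath N g (stdSimplex.vertex 0) = proj N (cusp (g • ((0 : ℚ) : OnePoint ℚ))) := by
  simp [maninPath, geodesicFun, smul_cusp]

lemma maninPath_one (N : ℕ) (g : SL(2, ℤ)) :
    maninPath N g (stdSimplex.vertex 1) = proj N (cusp (g • ∞)) := by
  simp [maninPath, geodesicFun, smul_cusp]

/-- The modular symbol `{g 0, g ∞}` in `H₁(X(N), ∂_N; ℝ)`. -/
def maninSymbol (N : ℕ) (g : SL(2, ℤ)) : RelH1 ℝ (cusps N) :=
  pathClass ℝ (maninPath N g) (maninPath_zero N g ▸ proj_cusp_mem N _)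
    (maninPath_one N g ▸ proj_cusp_mem N _)

/-- The subgroup `±Γ(N)` of `SL₂(ℤ)`. -/
def pmGamma (N : ℕ) : Subgroup SL(2, ℤ) where
  carrier := {g | g ∈ Gamma N ∨ -g ∈ Gamma N}
  one_mem' := Or.inl (one_mem _)
  mul_mem' {a b} ha hb := by
    rcases ha with ha | ha <;> rcases hb with hb | hb
    · exact Or.inl (mul_mem ha hb)
    · exact Or.inr (by simpa using mul_mem ha hb)
    · exact Or.inr (by simpa using mul_mem ha hb)
    · exact Or.inl (by simpa using mul_mem ha hb)
  inv_mem' {a} ha := by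
    rcases ha with ha | ha
    · exact Or.inl (inv_mem ha)
    · refine Or.inr ?_
      have h : (-a)⁻¹ = -a⁻¹ := inv_eq_of_mul_eq_one_right (by simp)
      exact h ▸ inv_mem ha

lemma mem_pmGamma {N : ℕ} {g : SL(2, ℤ)} : g ∈ pmGamma N ↔ g ∈ Gamma N ∨ -g ∈ Gamma N := Iff.rfl

instance (N : ℕ) : (pmGamma N).Normal where
  conj_mem a ha g := by
    have hn := Gamma_normal N
    rcases ha with ha | ha
    · exact Or.inl (hn.conj_mem a ha g)
    · exact Or.inr (by simpa using hn.conj_mem (-a) ha g)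

instance (N : ℕ) [NeZero N] : (pmGamma N).FiniteIndex :=
  Subgroup.finiteIndex_of_le (H := Gamma N) fun _ h => Or.inl h

/-- The group `±Γ(N) \ SL₂(ℤ)`, that is `SL₂(ℤ/N) / ±1`. -/
abbrev PSLmod (N : ℕ) : Type := SL(2, ℤ) ⧸ pmGamma N

instance (N : ℕ) [NeZero N] : Fintype (PSLmod N) := Fintype.ofFinite _

lemma neg_smul_ext (g : SL(2, ℤ)) (z : ExtUpperHalfPlane) : (-g) • z = g • z := by
  cases z with
  | point τ => exact congrArg point (ModularGroup.SL_neg_smul g τ)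
  | cusp c =>
    refine congrArg cusp ?_
    rw [smul_cusp_def, smul_cusp_def]
    cases c with
    | infty => simp [smul_infty_eq_ite]
    | coe q =>
      rw [smul_some_eq_ite, smul_some_eq_ite]
      have e : ∀ i j, mapGL ℚ (-g) i j = -mapGL ℚ g i j := fun i j => by simp
      have h : -mapGL ℚ g 1 0 * q + -mapGL ℚ g 1 1 =
        -(mapGL ℚ g 1 0 * q + mapGL ℚ g 1 1) := by ring
      have h' : -mapGL ℚ g 0 0 * q + -mapGL ℚ g 0 1 =
        -(mapGL ℚ g 0 0 * q + mapGL ℚ g 0 1) := by ring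
      simp only [e, h, h', neg_eq_zero, neg_div_neg_eq]

lemma maninPath_eq {N : ℕ} {g h : SL(2, ℤ)} (hgh : g⁻¹ * h ∈ pmGamma N) :
    maninPath N g = maninPath N h := by
  have hk : h * g⁻¹ ∈ pmGamma N := (inferInstance : (pmGamma N).Normal).mem_comm hgh
  ext t
  refine proj_eq_iff.mpr ?_
  have hinv := inv_mem hk
  rcases hinv with hk | hk
  · exact ⟨_, hk, by simp [smul_smul]⟩
  · exact ⟨_, hk, by rw [ContinuousMap.coe_mk, ContinuousMap.coe_mk, neg_smul_ext]; simp [smul_smul]⟩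

/-- The Manin generator `ξ(γ)`, for `γ` in `±Γ(N) \ SL₂(ℤ)`. -/
def xi (N : ℕ) : PSLmod N → RelH1 ℝ (cusps N) :=
  Quotient.lift (maninSymbol N) fun g h hgh => by
    have e := maninPath_eq (QuotientGroup.leftRel_apply.mp hgh)
    simp only [maninSymbol, e]

/-! ### The function `F` and the Eisenstein classes -/

/-- The trigonometric expression defining `F`, in terms of integer coordinates. -/
def trigF (N : ℕ) (x y : ℤ) : ℝ :=
  -(1 / 4) * ((Real.cos (Real.pi * x / N) + Real.cos (Real.pi * y / N)) /
    (Real.cos (Real.pi * x / N) - Real.cos (Real.pi * y / N)))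

/-- `F(P)` for `P ∈ (ℤ/N)²` and odd `N`: the expression `trigF N x y` at any integers `x`, `y`
that represent the coordinates of `P` and have odd difference (see `F_eq_trigF`); here `x` is
taken even and `y` odd. -/
def F (N : ℕ) (P : Fin 2 → ZMod N) : ℝ :=
  if Odd N then trigF N ((N + 1) * (P 0).cast) ((N + 1) * (P 1).cast + N) else 0

lemma trigF_congr {N : ℕ} (hN : Odd N) {x y x' y' : ℤ} (hx : (x : ZMod N) = x')
    (hy : (y : ZMod N) = y') (h : Odd (x - y)) (h' : Odd (x' - y')) :
    trigF N x y = trigF N x' y' := by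
  have hN0 : (N : ℝ) ≠ 0 := by exact_mod_cast hN.pos.ne'
  obtain ⟨a, ha⟩ := (ZMod.intCast_eq_intCast_iff_dvd_sub x x' N).mp hx
  obtain ⟨b, hb⟩ := (ZMod.intCast_eq_intCast_iff_dvd_sub y y' N).mp hy
  obtain rfl : x' = x + N * a := by linarith
  obtain rfl : y' = y + N * b := by linarith
  have hN' : Odd (N : ℤ) := by exact_mod_cast hN
  have hab : Even (a - b) := by
    have h2 : Even ((x + N * a - (y + N * b)) - (x - y)) := h'.sub_odd h
    have h3 : (x + N * a - (y + N * b)) - (x - y) = N * (a - b) := by ring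
    rw [h3, Int.even_mul] at h2
    exact h2.resolve_left (Int.not_even_iff_odd.mpr hN')
  have e : ∀ z c : ℤ, Real.cos (Real.pi * ((z + N * c : ℤ) : ℝ) / N) =
      (-1) ^ c * Real.cos (Real.pi * z / N) := fun z c => by
    rw [← Real.cos_add_int_mul_pi]
    congr 1
    push_cast
    field_simp
  have hs : (-1 : ℝ) ^ b = (-1) ^ a := by
    have : a = b + (a - b) := by ring
    rw [this, zpow_add₀ (by norm_num), hab.neg_one_zpow, mul_one]
  have hs0 : (-1 : ℝ) ^ a ≠ 0 := zpow_ne_zero _ (by norm_num)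
  simp only [trigF, e, hs, ← mul_add, ← mul_sub]
  rw [mul_div_mul_left _ _ hs0]

lemma F_eq_trigF {N : ℕ} (hN : Odd N) (P : Fin 2 → ZMod N) {x y : ℤ} (hx : (x : ZMod N) = P 0)
    (hy : (y : ZMod N) = P 1) (h : Odd (x - y)) : F N P = trigF N x y := by
  have hN' : Odd (N : ℤ) := by exact_mod_cast hN
  rw [F, if_pos hN]
  refine trigF_congr hN ?_ ?_ ?_ h
  · simp [hx]
  · simp [hy]
  · have h1 : Even ((N : ℤ) + 1) := hN'.add_odd odd_one
    exact (h1.mul_right _).sub_odd ((h1.mul_right _).add_odd hN')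

lemma F_neg (N : ℕ) (P : Fin 2 → ZMod N) : F N (-P) = F N P := by
  by_cases hN : Odd N
  · have hN' : Odd (N : ℤ) := by exact_mod_cast hN
    have h1 : Even ((N : ℤ) + 1) := hN'.add_odd odd_one
    have hodd : Odd (((N : ℤ) + 1) * (P 0).cast - (((N : ℤ) + 1) * (P 1).cast + N)) :=
      (h1.mul_right _).sub_odd ((h1.mul_right _).add_odd hN')
    rw [F_eq_trigF hN (-P) (x := -((N + 1) * (P 0).cast)) (y := -((N + 1) * (P 1).cast + N))
      (by simp) (by simp) (by simpa [sub_eq_add_neg, add_comm] using hodd.neg), F, if_pos hN]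
    simp [trigF, neg_div, -neg_add_rev]
  · simp [F, hN]

/-- Reduction of an integral matrix modulo `N`. -/
def reduceMod (N : ℕ) : SL(2, ℤ) →* SL(2, ZMod N) :=
  Matrix.SpecialLinearGroup.map (Int.castRingHom (ZMod N))

/-- The coefficient `F(γ⁻¹ P)`, for `γ` in `±Γ(N) \ SL₂(ℤ)`. -/
def coeffF (N : ℕ) (P : Fin 2 → ZMod N) : PSLmod N → ℝ :=
  Quotient.lift (fun g : SL(2, ℤ) => F N ((reduceMod N g⁻¹).1.mulVec P)) fun g h hgh => by
    have hgh' := QuotientGroup.leftRel_apply.mp hgh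
    have hh : h = g * (g⁻¹ * h) := by group
    set k := g⁻¹ * h with hk
    have hinv : h⁻¹ = k⁻¹ * g⁻¹ := by rw [hh, mul_inv_rev]
    simp only [hinv]
    rcases inv_mem hgh' with h1 | h1
    · have h2 : reduceMod N k⁻¹ = 1 := h1
      rw [map_mul, h2, one_mul]
    · have h2 : reduceMod N (-k⁻¹) = 1 := h1
      have h3 : reduceMod N (k⁻¹ * g⁻¹) = -reduceMod N g⁻¹ := by
        have h4 : k⁻¹ * g⁻¹ = (-k⁻¹) * (-g⁻¹) := by simp
        rw [h4, map_mul, h2, one_mul]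
        ext i j
        simp [reduceMod]
      rw [h3]
      simp only [Matrix.SpecialLinearGroup.coe_neg, Matrix.neg_mulVec, F_neg]

/-- The Eisenstein class `E_P = ∑ F(γ⁻¹ P) ξ(γ)`, summed over `γ ∈ ±Γ(N) \ SL₂(ℤ)`. -/
def eisensteinClass (N : ℕ) [NeZero N] (P : Fin 2 → ZMod N) : RelH1 ℝ (cusps N) :=
  ∑ γ : PSLmod N, coeffF N P γ • xi N γ

/-- The boundary map `δ : H₁(X(N), ∂_N; ℝ) → ℝ[∂_N]`. -/
def delta (N : ℕ) : RelH1 ℝ (cusps N) →ₗ[ℝ] (cusps N →₀ ℝ) := connecting ℝ (cusps N)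

/-! ### Points of order `N` modulo `±1` and cusps -/

/-- Points of order `N` in `(ℤ/N)²`. -/
abbrev OrderPoint (N : ℕ) : Type := {P : Fin 2 → ZMod N // addOrderOf P = N}

/-- The relation `Q = ±P` on points of order `N`. -/
def pmSetoid (N : ℕ) : Setoid (OrderPoint N) where
  r P Q := P.1 = Q.1 ∨ P.1 = -Q.1
  iseqv := ⟨fun _ => Or.inl rfl, fun {P Q} h => h.imp Eq.symm fun h => by rw [h, neg_neg],
    fun {P Q R} h h' => by
      rcases h with h | h <;> rcases h' with h' | h' <;> simp [h, h']⟩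

/-- The set `C_N` of points of order `N` in `(ℤ/N)²` modulo `±1`. -/
def CN (N : ℕ) : Type := Quotient (pmSetoid N)

/-- The class in `C_N` of a point of order `N`. -/
def CN.mk {N : ℕ} (P : OrderPoint N) : CN N := Quotient.mk (pmSetoid N) P

lemma CN.mk_eq_iff {N : ℕ} {P Q : OrderPoint N} :
    CN.mk P = CN.mk Q ↔ P.1 = Q.1 ∨ P.1 = -Q.1 := Quotient.eq (r := pmSetoid N)

instance (N : ℕ) [NeZero N] : Finite (CN N) :=
  inferInstanceAs (Finite (Quotient (pmSetoid N)))

instance (N : ℕ) [NeZero N] : Fintype (CN N) := Fintype.ofFinite _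

lemma addOrderOf_intCast {N : ℕ} {u v : ℤ} (h : IsCoprime u v) :
    addOrderOf (![(u : ZMod N), (v : ZMod N)] : Fin 2 → ZMod N) = N := by
  refine Nat.dvd_antisymm (addOrderOf_dvd_of_nsmul_eq_zero ?_) ?_
  · ext i
    fin_cases i <;> simp
  · have h0 := addOrderOf_nsmul_eq_zero (![(u : ZMod N), (v : ZMod N)] : Fin 2 → ZMod N)
    set n := addOrderOf (![(u : ZMod N), (v : ZMod N)] : Fin 2 → ZMod N)
    have hu : (n : ZMod N) * u = 0 := by simpa using congrFun h0 0
    have hv : (n : ZMod N) * v = 0 := by simpa using congrFun h0 1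
    obtain ⟨a, b, hab⟩ := h
    have hab' : (a : ZMod N) * u + b * v = 1 := by
      have := congrArg (Int.cast : ℤ → ZMod N) hab
      push_cast at this
      exact this
    have hn : (n : ZMod N) = 0 := by linear_combination a * hu + b * hv - (n : ZMod N) * hab'
    exact (ZMod.natCast_eq_zero_iff n N).mp hn

/-- Coprime integers `(u, v)` with `u / v` the given point of `ℙ¹(ℚ)`. -/
def cuspCoord : OnePoint ℚ → ℤ × ℤ
  | OnePoint.infty => (1, 0)
  | OnePoint.some q => (q.num, q.den)

lemma cuspCoord_coprime (c : OnePoint ℚ) : IsCoprime (cuspCoord c).1 (cuspCoord c).2 := by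
  cases c with
  | infty => exact (isCoprime_one_left : IsCoprime (1 : ℤ) 0)
  | coe q => exact Rat.isCoprime_num_den q

/-- The point of order `N` given by `(u, v)` modulo `N`, for a cusp `u / v` in lowest terms. -/
def cuspPoint (N : ℕ) (c : OnePoint ℚ) : OrderPoint N :=
  ⟨![((cuspCoord c).1 : ZMod N), ((cuspCoord c).2 : ZMod N)],
    addOrderOf_intCast (cuspCoord_coprime c)⟩

/-- The point `u / v` of `ℙ¹(ℚ)`. -/
def ratio (u v : ℤ) : OnePoint ℚ := if v = 0 then ∞ else ((u / v : ℚ) : OnePoint ℚ)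

lemma ratio_aux (a b c d : ℤ) (q : ℚ) :
    (if (c : ℚ) * q + d = 0 then (∞ : OnePoint ℚ) else ((a * q + b) / (c * q + d) : ℚ)) =
      ratio (a * q.num + b * q.den) (c * q.num + d * q.den) := by
  have hd : (q.den : ℚ) ≠ 0 := by exact_mod_cast q.den_nz
  have e : ∀ a b : ℤ, (a : ℚ) * q + b = (a * q.num + b * q.den) / q.den := fun a b => by
    rw [eq_div_iff hd, add_mul, mul_assoc, Rat.mul_den_eq_num]
  have hz : ((c : ℚ) * q.num + d * q.den = 0) ↔ (c * q.num + d * q.den = 0) := by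
    exact_mod_cast Iff.rfl
  simp only [ratio, e, div_eq_zero_iff, hd, or_false, hz]
  by_cases h : c * q.num + d * q.den = 0
  · rw [if_pos h, if_pos h]
  · rw [if_neg h, if_neg h, div_div_div_cancel_right₀ hd]
    push_cast
    rfl

lemma smul_eq_ratio (g : SL(2, ℤ)) (c : OnePoint ℚ) :
    g • c = ratio (g 0 0 * (cuspCoord c).1 + g 0 1 * (cuspCoord c).2)
      (g 1 0 * (cuspCoord c).1 + g 1 1 * (cuspCoord c).2) := by
  rw [smul_cusp_def]
  cases c with
  | infty =>
    rw [smul_infty_eq_ite]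
    simp [cuspCoord, ratio, mapGL_apply]
  | coe q => exact smul_some_eq_ite.trans (ratio_aux _ _ _ _ q)

lemma cuspCoord_ratio {u v : ℤ} (h : IsCoprime u v) :
    cuspCoord (ratio u v) = (u, v) ∨ cuspCoord (ratio u v) = (-u, -v) := by
  have hpos : ∀ {u v : ℤ}, IsCoprime u v → 0 < v → cuspCoord (ratio u v) = (u, v) := by
    intro u v h hv
    have hc : u.natAbs.Coprime v.natAbs := Int.isCoprime_iff_gcd_eq_one.mp h
    have h1 := Rat.num_div_eq_of_coprime hv hc
    have h2 := Rat.den_div_eq_of_coprime hv hc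
    simp only [ratio, if_neg hv.ne', cuspCoord, h1, h2]
  rcases lt_trichotomy v 0 with hv | rfl | hv
  · refine Or.inr ?_
    have he : ratio u v = ratio (-u) (-v) := by
      simp [ratio, neg_div_neg_eq]
    rw [he]
    exact hpos h.neg_neg (by linarith)
  · have hu : IsUnit u := isCoprime_zero_right.mp h
    rcases Int.isUnit_iff.mp hu with rfl | rfl
    · exact Or.inl rfl
    · exact Or.inr rfl
  · exact Or.inl (hpos h hv)

/-- Cusps equivalent under `Γ(N)` have the same class in `C_N`. -/
lemma cuspPoint_smul {N : ℕ} {g : SL(2, ℤ)} (hg : g ∈ Gamma N) (c : OnePoint ℚ) :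
    CN.mk (cuspPoint N (g • c)) = CN.mk (cuspPoint N c) := by
  obtain ⟨h00, h01, h10, h11⟩ := Gamma_mem.mp hg
  have hdet : g 0 0 * g 1 1 - g 0 1 * g 1 0 = 1 := by
    have := g.det_coe
    rwa [Matrix.det_fin_two] at this
  have hcop : IsCoprime (g 0 0 * (cuspCoord c).1 + g 0 1 * (cuspCoord c).2)
      (g 1 0 * (cuspCoord c).1 + g 1 1 * (cuspCoord c).2) := by
    obtain ⟨a, b, hab⟩ := cuspCoord_coprime c
    exact ⟨a * g 1 1 - b * g 1 0, b * g 0 0 - a * g 0 1, by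
      linear_combination (a * (cuspCoord c).1 + b * (cuspCoord c).2) * hdet + hab⟩
  rw [CN.mk_eq_iff]
  rcases cuspCoord_ratio hcop with h | h <;> rw [← smul_eq_ratio] at h
  · left
    simp [cuspPoint, h, h00, h01, h10, h11]
  · right
    simp [cuspPoint, h, h00, h01, h10, h11]

/-- The map `φ : ∂_N → C_N` which sends the cusp `Γ(N) (u / v)` to the class of `(u, v)`. -/
def phi (N : ℕ) (x : cusps N) : CN N := CN.mk (cuspPoint N x.2.choose)

lemma phi_proj (N : ℕ) (c : OnePoint ℚ) :
    phi N ⟨proj N (cusp c), proj_cusp_mem N c⟩ = CN.mk (cuspPoint N c) := by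
  obtain ⟨g, hg, h⟩ := proj_eq_iff.mp (proj_cusp_mem N c).choose_spec
  rw [smul_cusp] at h
  have h' := (ExtUpperHalfPlane.cusp.inj h)
  rw [phi, ← h', cuspPoint_smul hg]

/-- The action of units modulo `N` on points of order `N`. -/
def unitMul {N : ℕ} (μ : (ZMod N)ˣ) (P : OrderPoint N) : OrderPoint N :=
  ⟨fun i => (μ : ZMod N) * P.1 i, by
    have hi : Function.Injective fun Q : Fin 2 → ZMod N => (μ : ZMod N) • Q := fun a b h => by
      ext i
      simpa using congrFun h i
    exact (addOrderOf_injective (DistribSMul.toAddMonoidHom (Fin 2 → ZMod N) (μ : ZMod N)) hi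
      P.1).trans P.2⟩

/-- The point `P_∞ = (1, 0)`. -/
def Pinfty (N : ℕ) : Fin 2 → ZMod N := ![1, 0]

/-- The group `(ℤ/N)ˣ / ±1`. -/
abbrev UnitsModSign (N : ℕ) : Type := (ZMod N)ˣ ⧸ Subgroup.zpowers (-1 : (ZMod N)ˣ)

instance (N : ℕ) [NeZero N] : Fintype (UnitsModSign N) := Fintype.ofFinite _

lemma eq_or_eq_neg_of_mem {N : ℕ} {μ ν : (ZMod N)ˣ}
    (h : μ⁻¹ * ν ∈ Subgroup.zpowers (-1 : (ZMod N)ˣ)) : ν = μ ∨ ν = -μ := by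
  obtain ⟨k, hk⟩ := Subgroup.mem_zpowers_iff.mp h
  rcases Int.even_or_odd k with h2 | h2
  · rw [h2.neg_one_zpow] at hk
    exact Or.inl (inv_mul_eq_one.mp hk.symm).symm
  · rw [h2.neg_one_zpow, eq_inv_mul_iff_mul_eq] at hk
    exact Or.inr (by rw [← hk]; simp)

/-- The term `(F(μ P_∞) + 1/4) (μ⁻¹ P)` of `ℝ[C_N]`, which depends only on the class of `μ` in
`(ℤ/N)ˣ / ±1`. -/
def orbitTerm {N : ℕ} (P : OrderPoint N) : UnitsModSign N → (CN N →₀ ℝ) :=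
  Quotient.lift (fun μ : (ZMod N)ˣ =>
    Finsupp.single (CN.mk (unitMul μ⁻¹ P)) (F N ((μ : ZMod N) • Pinfty N) + 1 / 4)) fun μ ν h => by
    rcases eq_or_eq_neg_of_mem (QuotientGroup.leftRel_apply.mp h) with rfl | rfl
    · rfl
    · have h1 : CN.mk (unitMul (-μ)⁻¹ P) = CN.mk (unitMul μ⁻¹ P) := by
        refine CN.mk_eq_iff.mpr (Or.inr ?_)
        have h2 : (-μ)⁻¹ = -μ⁻¹ := inv_eq_of_mul_eq_one_right (by simp)
        ext i
        simp [unitMul, h2]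
      simp only [h1, Units.val_neg, neg_smul, F_neg]

end EisensteinCycle
end

/-!
The cusps are the points `g ∞`, and the class of `g ∞` in `C_N` is the first column of `g` modulo
`N`, up to sign. Every point of order `N` lifts to a coprime pair of integers, that is to the first
column of some `g ∈ SL₂(ℤ)` (`exists_colClass`), and two matrices with the same first column in `C_N` differ,
modulo `±Γ(N)`, by a unique `T ^ k` with `0 ≤ k < N` (`exists_mul_T_pow`, `mul_T_pow_injOn`). As
`T` fixes `∞`, this gives the bijection `∂_N → C_N`.

The boundary of `ξ(γ)` is the first column of `γ` minus the second one. Right multiplication by `S`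
exchanges the two columns and changes the sign of `F(γ⁻¹ P)`, so the boundary of the Eisenstein
class is twice `∑ F(γ⁻¹ P) (γ ∞)` (`mapDomain_delta_eisensteinClass`). Its coefficient at the first
column of `g` is therefore `2 ∑ F(x - k y, y)`, the sum being over `k` modulo `N`, where `(x, y)`
are the coordinates of `P` in the basis of the columns of `g`.

If `y = 0`, then `x` is a unit, all the terms equal `F(x, 0)`, and exactly one element `μ = ±x` of
`(ℤ/N)ˣ / ±1` contributes to the right-hand side. If `y ≠ 0`, no `μ` contributes, and the claim is
`∑ F(x - k y, y) = -N / 4` (`sum_F_of_ne_zero`). With representatives `y` even and `x` odd, partial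
fractions give
`F(u, y) = -1/4 - 1/4 cot(π y / N) (cot(π (y + u) / 2N) + cot(π (y - u) / 2N))`,
and for `u = x - k y` the last factor is `D(k + 1) - D(k - 1)` with `D(k) = cot(π (k y - x) / 2N)`.
As `D` has period `N`, the sum over `k` telescopes to zero.
-/

namespace EisensteinCycle

open ExtUpperHalfPlane OnePoint Matrix.SpecialLinearGroup

/-! ### Summation of `F` along a horocycle -/

lemma sin_pi_mul_div_ne_zero {M : ℕ} (hM : M ≠ 0) {n : ℤ} (h : ¬ (M : ℤ) ∣ n) :
    Real.sin (Real.pi * n / M) ≠ 0 := by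
  intro h0
  obtain ⟨m, hm⟩ := Real.sin_eq_zero_iff.mp h0
  have hM' : (M : ℝ) ≠ 0 := by exact_mod_cast hM
  rw [eq_div_iff hM'] at hm
  have h1 : (m * M : ℝ) = n := mul_left_cancel₀ Real.pi_ne_zero (by linear_combination hm)
  exact h ⟨m, by rw [mul_comm]; exact_mod_cast h1.symm⟩

lemma cot_add_int_mul_pi (x : ℝ) (n : ℤ) : Real.cot (x + n * Real.pi) = Real.cot x := by
  rw [Real.cot_eq_cos_div_sin, Real.cot_eq_cos_div_sin, Real.cos_add_int_mul_pi,
    Real.sin_add_int_mul_pi, mul_div_mul_left _ _ (zpow_ne_zero _ (by norm_num))]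

/-- The partial fraction decomposition of `trigF` in the variable `u`. -/
lemma trigF_eq_cot {N : ℕ} {u y : ℤ} (hy : Real.sin (Real.pi * y / N) ≠ 0)
    (h1 : Real.sin (Real.pi * (y + u) / (2 * N)) ≠ 0)
    (h2 : Real.sin (Real.pi * (y - u) / (2 * N)) ≠ 0) :
    trigF N u y = -(1 / 4) - 1 / 4 * Real.cot (Real.pi * y / N) *
      (Real.cot (Real.pi * (y + u) / (2 * N)) + Real.cot (Real.pi * (y - u) / (2 * N))) := by
  have ey : Real.pi * y / N = Real.pi * (y + u) / (2 * N) + Real.pi * (y - u) / (2 * N) := by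
    ring
  have eu : Real.pi * u / N = Real.pi * (y + u) / (2 * N) - Real.pi * (y - u) / (2 * N) := by
    ring
  rw [trigF, ey, eu]
  rw [ey] at hy
  generalize Real.pi * (y + u) / (2 * N) = A at *
  generalize Real.pi * (y - u) / (2 * N) = B at *
  simp only [Real.cot_eq_cos_div_sin]
  have e : Real.cos (A - B) - Real.cos (A + B) = 2 * Real.sin A * Real.sin B := by
    rw [Real.cos_sub, Real.cos_add]; ring
  have e' : Real.cos (A - B) + Real.cos (A + B) = 2 * Real.cos A * Real.cos B := by
    rw [Real.cos_sub, Real.cos_add]; ring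
  have es : Real.cos A / Real.sin A + Real.cos B / Real.sin B =
      Real.sin (A + B) / (Real.sin A * Real.sin B) := by
    rw [Real.sin_add]; field_simp; ring
  rw [e, e', es, Real.cos_add]
  field_simp
  ring

/-- The cotangents of `trigF_eq_cot` telescope along the progression `x - k y`. -/
lemma sum_trigF {N : ℕ} (hN : N ≠ 0) {x y : ℤ} (hx : Odd x) (hy : Even y) (hyN : ¬ (N : ℤ) ∣ y) :
    ∑ k ∈ Finset.range N, trigF N (x - k * y) y = -(N / 4 : ℝ) := by
  have hN' : (N : ℝ) ≠ 0 := by exact_mod_cast hN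
  have hodd : ∀ n : ℤ, Odd n → Real.sin (Real.pi * n / (2 * N)) ≠ 0 := fun n hn => by
    have h := sin_pi_mul_div_ne_zero (M := 2 * N) (by simpa using hN) (n := n) fun hd =>
      Int.not_even_iff_odd.mpr hn (even_iff_two_dvd.mpr
        ((Dvd.intro _ (by push_cast; rfl)).trans hd))
    push_cast at h
    exact h
  set D : ℤ → ℝ := fun k => Real.cot (Real.pi * ((k * y - x : ℤ) : ℝ) / (2 * N)) with hD
  -- The arguments of `cot` at `k + N` and `k` differ by `π y / 2`, and `y` is even.
  have hper : ∀ k, D (k + N) = D k := fun k => by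
    obtain ⟨z, hz⟩ := hy
    simp only [hD]
    rw [← cot_add_int_mul_pi (Real.pi * ((k * y - x : ℤ) : ℝ) / (2 * N)) z]
    congr 1
    rw [hz]
    push_cast
    field_simp
    ring
  -- `D (k + 1) - D (k - 1)` is the increment of `D k + D (k - 1)`.
  have hterm : ∀ k : ℕ, trigF N (x - k * y) y = -(1 / 4) - 1 / 4 * Real.cot (Real.pi * y / N) *
      ((D ((k + 1 : ℕ) : ℤ) + D ((k + 1 : ℕ) - 1)) - (D (k : ℤ) + D (k - 1))) := fun k => by
    have o1 : Odd (y + (x - k * y)) := hy.add_odd (hx.sub_even (hy.mul_left _))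
    have o2 : Odd (y - (x - k * y)) := hy.sub_odd (hx.sub_even (hy.mul_left _))
    have s1 := hodd _ o1
    have s2 := hodd _ o2
    rw [Int.cast_add] at s1
    rw [Int.cast_sub] at s2
    rw [trigF_eq_cot (sin_pi_mul_div_ne_zero hN hyN) s1 s2]
    have e1 : Real.cot (Real.pi * (y + ((x - k * y : ℤ) : ℝ)) / (2 * N)) = -D (k - 1) := by
      simp only [hD, Real.cot_eq_cos_div_sin, ← div_neg, ← Real.sin_neg]
      rw [← Real.cos_neg]
      congr 2 <;> (push_cast; ring)
    have e2 : Real.cot (Real.pi * (y - ((x - k * y : ℤ) : ℝ)) / (2 * N)) = D ((k + 1 : ℕ) : ℤ) := by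
      simp only [hD]
      congr 1
      push_cast
      ring
    have e3 : (((k + 1 : ℕ) : ℤ) - 1) = k := by push_cast; ring
    rw [e1, e2, e3]
    ring
  rw [Finset.sum_congr rfl fun k _ => hterm k, Finset.sum_sub_distrib, ← Finset.mul_sum,
    Finset.sum_range_sub fun k : ℕ => D (k : ℤ) + D (k - 1)]
  have p1 : D ((N : ℕ) : ℤ) = D ((0 : ℕ) : ℤ) := by simpa using hper 0
  have p2 : D ((N : ℤ) - 1) = D (((0 : ℕ) : ℤ) - 1) := by
    rw [← hper (((0 : ℕ) : ℤ) - 1)]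
    congr 1
  rw [p1, p2]
  simp
  ring

/-- Every class modulo the odd number `N` has representatives of both parities; an even one is
used for `y` and an odd one for `x`. -/
lemma sum_F_of_ne_zero {N : ℕ} (hN : Odd N) (x y : ZMod N) (hy : y ≠ 0) :
    ∑ k ∈ Finset.range N, F N ![x - k * y, y] = -(N / 4 : ℝ) := by
  have hN' : Odd (N : ℤ) := by exact_mod_cast hN
  have h1 : Even ((N : ℤ) + 1) := hN'.add_odd odd_one
  have hxo : Odd ((N + 1) * (x.cast : ℤ) + N) := (h1.mul_right _).add_odd hN'
  have hye : Even ((N + 1) * (y.cast : ℤ)) := h1.mul_right _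
  rw [← sum_trigF hN.pos.ne' hxo hye fun hd => hy ?_]
  · refine Finset.sum_congr rfl fun k _ => F_eq_trigF hN _ ?_ ?_ ?_
    · simp
    · simp
    · exact (hxo.sub_even (hye.mul_left _)).sub_even hye
  · have := (ZMod.intCast_zmod_eq_zero_iff_dvd _ N).mpr hd
    simpa using this

/-- `F` is antisymmetric under exchange of the coordinates, and even in each of them. -/
lemma F_swap (N : ℕ) (a b : ZMod N) : F N ![-b, a] = -F N ![a, b] := by
  by_cases hN : Odd N
  · have hN' : Odd (N : ℤ) := by exact_mod_cast hN
    have h1 : Even ((N : ℤ) + 1) := hN'.add_odd odd_one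
    have hae : Even ((N + 1) * (a.cast : ℤ)) := h1.mul_right _
    have hbo : Odd ((N + 1) * (b.cast : ℤ) + N) := (h1.mul_right _).add_odd hN'
    rw [F_eq_trigF hN ![-b, a] (x := -((N + 1) * b.cast + N)) (y := (N + 1) * a.cast)
      (by simp) (by simp) (hbo.neg.sub_even hae), F_eq_trigF hN ![a, b]
      (x := (N + 1) * a.cast) (y := (N + 1) * b.cast + N) (by simp) (by simp) (hae.sub_odd hbo)]
    have e : ∀ z : ℤ, Real.cos (Real.pi * ((-z : ℤ) : ℝ) / N) = Real.cos (Real.pi * z / N) :=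
      fun z => by
        rw [← Real.cos_neg]
        congr 1
        push_cast
        ring
    simp only [trigF, e]
    rw [← neg_sub (Real.cos _), div_neg, add_comm (Real.cos _)]
    ring
  · simp [F, hN]

/-! ### Points of order `N` as columns of unimodular matrices -/

lemma isCoprime_col (g : SL(2, ℤ)) : IsCoprime (g 0 0) (g 1 0) := by
  have h := g.det_coe
  rw [Matrix.det_fin_two] at h
  exact ⟨g 1 1, -g 0 1, by linear_combination h⟩

/-- The class in `C_N` of the first column of `g`. -/
def colClass (N : ℕ) (g : SL(2, ℤ)) : CN N :=
  CN.mk ⟨![(g 0 0 : ZMod N), (g 1 0 : ZMod N)], addOrderOf_intCast (isCoprime_col g)⟩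

lemma cuspPoint_smul_infty (N : ℕ) (g : SL(2, ℤ)) :
    CN.mk (cuspPoint N (g • ∞)) = colClass N g := by
  have h := cuspCoord_ratio (isCoprime_col g)
  have e : g • (∞ : OnePoint ℚ) = ratio (g 0 0) (g 1 0) := by
    rw [smul_eq_ratio]
    simp [cuspCoord]
  rw [← e] at h
  rw [colClass, CN.mk_eq_iff]
  rcases h with h | h
  · left
    simp [cuspPoint, h]
  · right
    simp [cuspPoint, h]

lemma exists_smul_infty (c : OnePoint ℚ) : ∃ g : SL(2, ℤ), g • ∞ = c :=
  OnePoint.exists_mem_SL2 ℤ c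

/-- If `gcd (a, b, N) = 1` then `a` can be changed modulo `N` to become coprime to `b ≠ 0`. -/
lemma exists_isCoprime_add_mul {a : ℤ} {b N : ℕ} (hb : b ≠ 0)
    (h : ∀ d : ℕ, (d : ℤ) ∣ a → d ∣ b → d ∣ N → d = 1) :
    ∃ r : ℤ, IsCoprime (a + N * r) (b : ℤ) := by
  have : NeZero b := ⟨hb⟩
  set d := Nat.gcd b N with hd
  have hcop : IsCoprime a (d : ℤ) := by
    rw [Int.isCoprime_iff_gcd_eq_one]
    exact h _ (Int.gcd_dvd_left _ _)
      ((Int.natCast_dvd_natCast.mp (Int.gcd_dvd_right a (d : ℤ))).trans (Nat.gcd_dvd_left b N))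
      ((Int.natCast_dvd_natCast.mp (Int.gcd_dvd_right a (d : ℤ))).trans (Nat.gcd_dvd_right b N))
  -- A unit modulo `gcd (b, N)` lifts to a unit modulo `b`.
  obtain ⟨u, hu⟩ := ZMod.unitsMap_surjective (Nat.gcd_dvd_left b N)
    ((ZMod.coe_int_isUnit_iff_isCoprime a d).mpr hcop.symm).unit
  have hu' : (((u : ZMod b).cast : ℤ) : ZMod d) = (a : ZMod d) := by
    have := congrArg Units.val hu
    rw [ZMod.unitsMap_val, IsUnit.unit_spec] at this
    rw [← this]
    simp
  obtain ⟨t, ht⟩ := (ZMod.intCast_eq_intCast_iff_dvd_sub _ _ d).mp hu'.symm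
  have hbez := Nat.gcd_eq_gcd_ab b N
  rw [← hd] at hbez
  refine ⟨Nat.gcdB b N * t, ?_⟩
  have hcu : IsCoprime ((u : ZMod b).cast : ℤ) (b : ℤ) :=
    ((ZMod.coe_int_isUnit_iff_isCoprime _ b).mp (by simp)).symm
  have e : a + N * (Nat.gcdB b N * t) =
      ((u : ZMod b).cast : ℤ) + b * (-(Nat.gcdA b N * t)) := by
    linear_combination -ht - t * hbez
  rw [e]
  exact hcu.add_mul_left_left _

/-- The coordinates of a point of order `N` have no common divisor with `N`. -/
lemma eq_one_of_dvd_coords {N : ℕ} [NeZero N] (P : OrderPoint N) {d : ℕ} (hdN : d ∣ N)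
    (h : ∀ i, (d : ZMod N) ∣ P.1 i) : d = 1 := by
  obtain ⟨m, hm⟩ := hdN
  have hz : (d : ZMod N) * m = 0 := by
    rw [← Nat.cast_mul, ← hm, ZMod.natCast_self]
  have h0 : m • P.1 = 0 := by
    ext i
    obtain ⟨c, hc⟩ := h i
    have hmi : (m : ZMod N) * P.1 i = 0 := by
      rw [hc]
      linear_combination c * hz
    simpa using hmi
  have hdvd := addOrderOf_dvd_of_nsmul_eq_zero h0
  rw [P.2] at hdvd
  have hm0 : 0 < m := Nat.pos_of_ne_zero fun h => NeZero.ne N (by rw [hm, h, mul_zero])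
  have hle := Nat.le_of_dvd hm0 hdvd
  rw [hm] at hle
  have hd0 : d ≠ 0 := fun h => NeZero.ne N (by rw [hm, h, zero_mul])
  have hd1 : d ≤ 1 := Nat.le_of_mul_le_mul_right (by simpa using hle) hm0
  omega

/-- Points of order `N` are reductions of coprime pairs of integers. -/
lemma exists_colClass {N : ℕ} [NeZero N] (Q : CN N) : ∃ g : SL(2, ℤ), colClass N g = Q := by
  obtain ⟨P, rfl⟩ := Quotient.exists_rep Q
  set a : ℤ := (P.1 0).cast with ha
  -- A positive representative of the second coordinate.
  set b : ℕ := (P.1 1).val + N with hb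
  have hb0 : b ≠ 0 := by have := NeZero.ne N; omega
  have haP : (a : ZMod N) = P.1 0 := by simp [ha]
  have hbP : (b : ZMod N) = P.1 1 := by simp [hb]
  obtain ⟨r, hr⟩ := exists_isCoprime_add_mul (a := a) (N := N) hb0 fun d hda hdb hdN =>
    eq_one_of_dvd_coords P hdN fun i => by
      fin_cases i
      · simpa [haP] using map_dvd (Int.castRingHom (ZMod N)) hda
      · simpa [hbP] using map_dvd (Nat.castRingHom (ZMod N)) hdb
  obtain ⟨g, hg0, hg1⟩ := hr.exists_SL2_col 0
  refine ⟨g, CN.mk_eq_iff.mpr (Or.inl ?_)⟩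
  ext i
  fin_cases i
  · simp [hg0, haP]
  · simp [hg1, hbP]

/-! ### Fibres of the first column -/

lemma coe_T_pow (k : ℕ) : (ModularGroup.T ^ k).1 = !![1, (k : ℤ); 0, 1] := by
  simpa using ModularGroup.coe_T_zpow (k : ℤ)

lemma mul_T_pow_apply (g : SL(2, ℤ)) (k : ℕ) :
    (g * ModularGroup.T ^ k) 0 0 = g 0 0 ∧ (g * ModularGroup.T ^ k) 0 1 = k * g 0 0 + g 0 1 ∧
    (g * ModularGroup.T ^ k) 1 0 = g 1 0 ∧ (g * ModularGroup.T ^ k) 1 1 = k * g 1 0 + g 1 1 := by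
  have hT := coe_T_pow k
  refine ⟨?_, ?_, ?_, ?_⟩ <;> simp [Matrix.SpecialLinearGroup.coe_mul, hT, Matrix.mul_apply,
    Fin.sum_univ_two, mul_comm]

lemma inv_mul_apply (g h : SL(2, ℤ)) :
    (g⁻¹ * h) 0 0 = g 1 1 * h 0 0 - g 0 1 * h 1 0 ∧
    (g⁻¹ * h) 0 1 = g 1 1 * h 0 1 - g 0 1 * h 1 1 ∧
    (g⁻¹ * h) 1 0 = g 0 0 * h 1 0 - g 1 0 * h 0 0 ∧
    (g⁻¹ * h) 1 1 = g 0 0 * h 1 1 - g 1 0 * h 0 1 := by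
  refine ⟨?_, ?_, ?_, ?_⟩ <;>
    simp [Matrix.SpecialLinearGroup.coe_mul, Matrix.SpecialLinearGroup.coe_inv,
      Matrix.adjugate_fin_two, Matrix.mul_apply, Fin.sum_univ_two] <;>
    ring

lemma det_mod (N : ℕ) (g : SL(2, ℤ)) :
    (g 0 0 : ZMod N) * g 1 1 - g 0 1 * g 1 0 = 1 := by
  have h := g.det_coe
  rw [Matrix.det_fin_two] at h
  exact_mod_cast congrArg (Int.cast : ℤ → ZMod N) h

lemma exists_mul_T_pow_of_col_eq {N : ℕ} [NeZero N] {g h : SL(2, ℤ)}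
    (h0 : (h 0 0 : ZMod N) = g 0 0) (h1 : (h 1 0 : ZMod N) = g 1 0) :
    ∃ k < N, (g * ModularGroup.T ^ k)⁻¹ * h ∈ Gamma N := by
  refine ⟨((g⁻¹ * h) 0 1 : ZMod N).val, ZMod.val_lt _, ?_⟩
  set k := ((g⁻¹ * h) 0 1 : ZMod N).val with hk
  have hk' : (k : ZMod N) = g 1 1 * h 0 1 - g 0 1 * h 1 1 := by
    rw [hk, ZMod.natCast_rightInverse, (inv_mul_apply g h).2.1]
    push_cast
    rfl
  obtain ⟨m1, m2, m3, m4⟩ := mul_T_pow_apply g k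
  obtain ⟨i1, i2, i3, i4⟩ := inv_mul_apply (g * ModularGroup.T ^ k) h
  have dg := det_mod N g
  have dh := det_mod N h
  rw [h0, h1] at dh
  rw [Gamma_mem, i1, i2, i3, i4, m1, m2, m3, m4]
  push_cast
  rw [h0, h1, hk']
  refine ⟨?_, ?_, ?_, ?_⟩
  · linear_combination dg
  · linear_combination (g 0 1 * h 1 1 - g 1 1 * h 0 1 : ZMod N) * dh
  · ring
  · linear_combination dh

/-- Two matrices whose first columns agree in `C_N` differ by a power of `T`, modulo `±Γ(N)`. -/
lemma exists_mul_T_pow {N : ℕ} [NeZero N] {g h : SL(2, ℤ)} (hc : colClass N h = colClass N g) :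
    ∃ k < N, (g * ModularGroup.T ^ k)⁻¹ * h ∈ pmGamma N := by
  rcases CN.mk_eq_iff.mp hc with h' | h'
  · obtain ⟨k, hk, hm⟩ := exists_mul_T_pow_of_col_eq (g := g) (h := h)
      (by simpa using congrFun h' 0) (by simpa using congrFun h' 1)
    exact ⟨k, hk, Or.inl hm⟩
  · obtain ⟨k, hk, hm⟩ := exists_mul_T_pow_of_col_eq (N := N) (g := g) (h := -h)
      (by simpa [neg_eq_iff_eq_neg] using congrFun h' 0)
      (by simpa [neg_eq_iff_eq_neg] using congrFun h' 1)
    exact ⟨k, hk, Or.inr (by simpa using hm)⟩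

lemma colClass_mul_T_pow (N : ℕ) (g : SL(2, ℤ)) (k : ℕ) :
    colClass N (g * ModularGroup.T ^ k) = colClass N g := by
  obtain ⟨h0, -, h1, -⟩ := mul_T_pow_apply g k
  exact CN.mk_eq_iff.mpr (Or.inl (by simp only [h0, h1]))

lemma mul_T_pow_injOn {N : ℕ} [NeZero N] (g : SL(2, ℤ)) {k l : ℕ} (hk : k < N) (hl : l < N)
    (h : (g * ModularGroup.T ^ k)⁻¹ * (g * ModularGroup.T ^ l) ∈ pmGamma N) : k = l := by
  have e : (g * ModularGroup.T ^ k)⁻¹ * (g * ModularGroup.T ^ l) =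
      (ModularGroup.T ^ k)⁻¹ * ModularGroup.T ^ l := by group
  rw [e] at h
  have hz : (((ModularGroup.T ^ k)⁻¹ * ModularGroup.T ^ l) 0 1 : ZMod N) = 0 := by
    rcases h with h | h
    · exact (Gamma_mem.mp h).2.1
    · simpa using (Gamma_mem.mp h).2.1
  rw [(inv_mul_apply _ _).2.1, coe_T_pow, coe_T_pow] at hz
  have hz' : (k : ZMod N) = (l : ZMod N) := by
    simp at hz
    linear_combination -hz
  rw [ZMod.natCast_eq_natCast_iff'] at hz'
  rwa [Nat.mod_eq_of_lt hk, Nat.mod_eq_of_lt hl] at hz'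

/-- The class in `C_N` of the first column, as a function on `±Γ(N) \ SL₂(ℤ)`. -/
def cosetCol (N : ℕ) : PSLmod N → CN N :=
  Quotient.lift (colClass N) fun g h hgh => by
    have hk : h * g⁻¹ ∈ pmGamma N :=
      (inferInstance : (pmGamma N).Normal).mem_comm (QuotientGroup.leftRel_apply.mp hgh)
    have e : h • (∞ : OnePoint ℚ) = (h * g⁻¹) • g • ∞ := by simp [smul_smul]
    rw [← cuspPoint_smul_infty, ← cuspPoint_smul_infty, e]
    rcases hk with hk | hk
    · rw [cuspPoint_smul hk]
    · have e2 := ExtUpperHalfPlane.cusp.inj (neg_smul_ext (h * g⁻¹) (cusp (g • ∞)))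
      rw [← e2, cuspPoint_smul hk]

/-- The fibre of `cosetCol` through `g` consists of the `N` cosets of the `g T ^ k`. -/
lemma sum_fibre {N : ℕ} [NeZero N] (f : PSLmod N → ℝ) (g : SL(2, ℤ)) :
    (∑ γ : PSLmod N, Finsupp.single (cosetCol N γ) (f γ)) (colClass N g) =
      ∑ k ∈ Finset.range N, f ((g * ModularGroup.T ^ k : SL(2, ℤ)) : PSLmod N) := by
  classical
  rw [Finsupp.finsetSum_apply]
  simp only [Finsupp.single_apply]
  rw [← Finset.sum_filter]
  symm
  refine Finset.sum_nbij (fun k => ((g * ModularGroup.T ^ k : SL(2, ℤ)) : PSLmod N)) ?_ ?_ ?_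
    fun _ _ => rfl
  · intro k _
    exact Finset.mem_filter.mpr ⟨Finset.mem_univ _, colClass_mul_T_pow N g k⟩
  · intro k hk l hl h
    exact mul_T_pow_injOn g (Finset.mem_range.mp hk) (Finset.mem_range.mp hl)
      (QuotientGroup.eq.mp h)
  · rintro γ hγ
    obtain ⟨h, rfl⟩ := QuotientGroup.mk_surjective γ
    have hc : colClass N h = colClass N g := (Finset.mem_filter.mp hγ).2
    obtain ⟨k, hk, hm⟩ := exists_mul_T_pow hc
    exact ⟨k, Finset.mem_coe.mpr (Finset.mem_range.mpr hk), QuotientGroup.eq.mpr hm⟩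

lemma T_pow_smul_infty (k : ℕ) : ModularGroup.T ^ k • (∞ : OnePoint ℚ) = ∞ := by
  have hT := coe_T_pow k
  rw [smul_eq_ratio]
  simp [hT, cuspCoord, ratio]

lemma phi_bijective (N : ℕ) [NeZero N] : Function.Bijective (phi N) := by
  constructor
  · rintro ⟨_, c, rfl⟩ ⟨_, c', rfl⟩ h
    obtain ⟨g, rfl⟩ := exists_smul_infty c
    obtain ⟨g', rfl⟩ := exists_smul_infty c'
    have h' : colClass N g = colClass N g' := by
      rw [← cuspPoint_smul_infty, ← cuspPoint_smul_infty, ← phi_proj, ← phi_proj]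
      exact h
    obtain ⟨k, -, hk⟩ := exists_mul_T_pow h'
    -- `maninPath` factors through `±Γ(N) \ SL₂(ℤ)`, hence so do its end points.
    have hp := ContinuousMap.congr_fun (maninPath_eq hk) (stdSimplex.vertex 1)
    rw [maninPath_one, maninPath_one, mul_smul, T_pow_smul_infty] at hp
    exact Subtype.ext hp.symm
  · intro Q
    obtain ⟨g, rfl⟩ := exists_colClass Q
    exact ⟨⟨proj N (cusp (g • ∞)), proj_cusp_mem N _⟩, by
      rw [phi_proj, cuspPoint_smul_infty]⟩

/-! ### The boundary of the Eisenstein classes -/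

lemma connecting_pathClass {R X : Type*} [CommRing R] [TopologicalSpace X] {A : Set X}
    [TotallyDisconnectedSpace A] (σ : C(stdSimplex ℝ (Fin 2), X))
    (h0 : σ (stdSimplex.vertex 0) ∈ A) (h1 : σ (stdSimplex.vertex 1) ∈ A) :
    connecting R A (pathClass R σ h0 h1) =
      Finsupp.single ⟨_, h1⟩ 1 - Finsupp.single ⟨_, h0⟩ 1 := by
  classical
  change Finsupp.subtypeDomain (· ∈ A) (pointsOf R (bdry R 0 (Finsupp.single σ 1))) = _
  rw [pointsOf_bdry_single]
  ext a
  simp [Finsupp.single_apply, Subtype.ext_iff]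

/-- The boundary of `ξ(γ)`; the starting point `γ 0` is `γ S ∞`. -/
lemma mapDomain_delta_xi (N : ℕ) (γ : PSLmod N) :
    Finsupp.mapDomain (phi N) (delta N (xi N γ)) =
      Finsupp.single (cosetCol N γ) 1 -
        Finsupp.single (cosetCol N (γ * (ModularGroup.S : SL(2, ℤ)))) 1 := by
  obtain ⟨g, rfl⟩ := QuotientGroup.mk_surjective γ
  change Finsupp.mapDomain (phi N) (connecting ℝ (cusps N) (maninSymbol N g)) = _
  rw [maninSymbol, connecting_pathClass, Finsupp.mapDomain_sub, Finsupp.mapDomain_single,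
    Finsupp.mapDomain_single]
  have e1 : ∀ h, phi N ⟨maninPath N g (stdSimplex.vertex 1), h⟩ = colClass N g := by
    rw [maninPath_one]
    intro h
    rw [phi_proj, cuspPoint_smul_infty]
  have e0 : ∀ h, phi N ⟨maninPath N g (stdSimplex.vertex 0), h⟩ =
      colClass N (g * ModularGroup.S) := by
    rw [maninPath_zero, ← S_smul_infty, ← mul_smul]
    intro h
    rw [phi_proj, cuspPoint_smul_infty]
  rw [e1, e0]
  rfl

lemma coeffF_mk (N : ℕ) (P : Fin 2 → ZMod N) (g : SL(2, ℤ)) : coeffF N P (g : PSLmod N) =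
    F N ![(g 1 1 : ZMod N) * P 0 - g 0 1 * P 1, g 0 0 * P 1 - g 1 0 * P 0] := by
  change F N ((reduceMod N g⁻¹).1.mulVec P) = _
  congr 1
  ext i
  fin_cases i <;>
    simp [reduceMod, Matrix.SpecialLinearGroup.coe_inv, Matrix.adjugate_fin_two, Matrix.mulVec,
      dotProduct, Fin.sum_univ_two] <;> ring

lemma coeffF_mul_S (N : ℕ) (P : Fin 2 → ZMod N) (γ : PSLmod N) :
    coeffF N P (γ * (ModularGroup.S : SL(2, ℤ))) = -coeffF N P γ := by
  obtain ⟨g, rfl⟩ := QuotientGroup.mk_surjective γ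
  rw [← QuotientGroup.mk_mul, coeffF_mk, coeffF_mk, ← F_swap, ← F_neg]
  congr 1
  ext i
  fin_cases i <;> 
    simp [Matrix.SpecialLinearGroup.coe_mul, ModularGroup.coe_S, Matrix.mul_apply,
      Fin.sum_univ_two]
  ring

/-- If `(x, y)` are the coordinates of `P` in the basis of the columns of `g`, those in the basis of
the columns of `g T ^ k` are `(x - k y, y)`. -/
lemma coeffF_mul_T_pow (N : ℕ) (P : Fin 2 → ZMod N) (g : SL(2, ℤ)) (k : ℕ) :
    coeffF N P ((g * ModularGroup.T ^ k : SL(2, ℤ)) : PSLmod N) =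
      F N ![(g 1 1 : ZMod N) * P 0 - g 0 1 * P 1 - k * (g 0 0 * P 1 - g 1 0 * P 0),
        g 0 0 * P 1 - g 1 0 * P 0] := by
  obtain ⟨h1, h2, h3, h4⟩ := mul_T_pow_apply g k
  rw [coeffF_mk, h1, h2, h3, h4]
  congr 1
  ext i
  fin_cases i
  · simp
    ring
  · rfl

/-- Both end points of the Manin generators contribute the same amount to the boundary: `S`
exchanges them, and it changes the sign of `F`. -/
lemma mapDomain_delta_eisensteinClass (N : ℕ) [NeZero N] (P : Fin 2 → ZMod N) :
    Finsupp.mapDomain (phi N) (delta N (eisensteinClass N P)) =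
      (2 : ℝ) • ∑ γ : PSLmod N, Finsupp.single (cosetCol N γ) (coeffF N P γ) := by
  have e : ∀ γ : PSLmod N, Finsupp.mapDomain (phi N) (delta N (coeffF N P γ • xi N γ)) =
      Finsupp.single (cosetCol N γ) (coeffF N P γ) +
        Finsupp.single (cosetCol N (γ * (ModularGroup.S : SL(2, ℤ))))
          (coeffF N P (γ * (ModularGroup.S : SL(2, ℤ)))) := fun γ => by
    rw [_root_.map_smul, Finsupp.mapDomain_smul, mapDomain_delta_xi, smul_sub, coeffF_mul_S,
      Finsupp.smul_single, Finsupp.smul_single, Finsupp.single_neg, sub_eq_add_neg]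
    simp
  rw [eisensteinClass, map_sum, Finsupp.mapDomain_finsetSum, Finset.sum_congr rfl fun γ _ => e γ,
    Finset.sum_add_distrib, two_smul]
  congr 1
  exact Equiv.sum_comp (Equiv.mulRight ((ModularGroup.S : SL(2, ℤ)) : PSLmod N))
    fun γ => Finsupp.single (cosetCol N γ) (coeffF N P γ)

lemma orbitTerm_mk {N : ℕ} (P : OrderPoint N) (μ : (ZMod N)ˣ) :
    orbitTerm P (μ : UnitsModSign N) = Finsupp.single (CN.mk (unitMul μ⁻¹ P))
      (F N ![(μ : ZMod N), 0] + 1 / 4) := by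
  have h : ((μ : ZMod N) • Pinfty N) = ![(μ : ZMod N), 0] := by
    ext i
    fin_cases i <;> simp [Pinfty]
  rw [← h]
  rfl

/-- In the basis of the columns of `g`, the point `P` has coordinates
`(g 1 1 * P 0 - g 0 1 * P 1, g 0 0 * P 1 - g 1 0 * P 0)`. If `μ⁻¹ P` is plus or minus the first
column of `g`, they are `(±μ, 0)`. -/
lemma coords_of_unitMul {N : ℕ} {P : OrderPoint N} {μ : (ZMod N)ˣ} {g : SL(2, ℤ)}
    (h : CN.mk (unitMul μ⁻¹ P) = colClass N g) :
    (g 0 0 : ZMod N) * P.1 1 - g 1 0 * P.1 0 = 0 ∧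
      ((g 1 1 : ZMod N) * P.1 0 - g 0 1 * P.1 1 = μ ∨
        (g 1 1 : ZMod N) * P.1 0 - g 0 1 * P.1 1 = -μ) := by
  have dg := det_mod N g
  have hμ : (μ : ZMod N) * ((μ⁻¹ : (ZMod N)ˣ) : ZMod N) = 1 := by simp
  rcases CN.mk_eq_iff.mp h with h' | h'
  · have h0 : ((μ⁻¹ : (ZMod N)ˣ) : ZMod N) * P.1 0 = g 0 0 := congrFun h' 0
    have h1 : ((μ⁻¹ : (ZMod N)ˣ) : ZMod N) * P.1 1 = g 1 0 := congrFun h' 1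
    have p0 : P.1 0 = μ * g 0 0 := by linear_combination μ * h0 - P.1 0 * hμ
    have p1 : P.1 1 = μ * g 1 0 := by linear_combination μ * h1 - P.1 1 * hμ
    rw [p0, p1]
    exact ⟨by ring, Or.inl (by linear_combination μ * dg)⟩
  · have h0 : ((μ⁻¹ : (ZMod N)ˣ) : ZMod N) * P.1 0 = -g 0 0 := congrFun h' 0
    have h1 : ((μ⁻¹ : (ZMod N)ˣ) : ZMod N) * P.1 1 = -g 1 0 := congrFun h' 1
    have p0 : P.1 0 = -(μ * g 0 0) := by linear_combination μ * h0 - P.1 0 * hμ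
    have p1 : P.1 1 = -(μ * g 1 0) := by linear_combination μ * h1 - P.1 1 * hμ
    rw [p0, p1]
    exact ⟨by ring, Or.inr (by linear_combination -(μ : ZMod N) * dg)⟩

/-- A point of order `N` proportional to the first column of `g` is a unit multiple of it. -/
lemma exists_unit_of_proportional {N : ℕ} [NeZero N] (P : OrderPoint N) (g : SL(2, ℤ))
    (hy : (g 0 0 : ZMod N) * P.1 1 - g 1 0 * P.1 0 = 0) :
    ∃ μ : (ZMod N)ˣ, (g 1 1 : ZMod N) * P.1 0 - g 0 1 * P.1 1 = μ ∧
      CN.mk (unitMul μ⁻¹ P) = colClass N g := by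
  have dg := det_mod N g
  set x : ZMod N := g 1 1 * P.1 0 - g 0 1 * P.1 1 with hx
  have p0 : P.1 0 = x * g 0 0 := by
    rw [hx]; linear_combination (-P.1 0) * dg + (g 0 1 : ZMod N) * hy
  have p1 : P.1 1 = x * g 1 0 := by
    rw [hx]; linear_combination (-P.1 1) * dg + (g 1 1 : ZMod N) * hy
  have hu : IsUnit x := by
    obtain ⟨d, hd, u, hu, he⟩ := ZMod.eq_unit_mul_divisor x
    have hdx : (d : ZMod N) ∣ x := ⟨u, by rw [he, mul_comm]⟩
    have hd1 : d = 1 := eq_one_of_dvd_coords P hd fun i => by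
      fin_cases i
      · exact p0 ▸ hdx.mul_right _
      · exact p1 ▸ hdx.mul_right _
    rw [he, hd1]
    simpa using hu
  obtain ⟨μ, hμx⟩ := hu
  have hμ : (((μ⁻¹ : (ZMod N)ˣ) : ZMod N)) * x = 1 := by rw [← hμx]; simp
  refine ⟨μ, hμx.symm, CN.mk_eq_iff.mpr (Or.inl ?_)⟩
  ext i
  fin_cases i
  · change ((μ⁻¹ : (ZMod N)ˣ) : ZMod N) * P.1 0 = g 0 0
    rw [p0, ← mul_assoc, hμ, one_mul]
  · change ((μ⁻¹ : (ZMod N)ˣ) : ZMod N) * P.1 1 = g 1 0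
    rw [p1, ← mul_assoc, hμ, one_mul]

lemma mapDomain_delta_eisensteinClass_eq {N : ℕ} [NeZero N] (hN : Odd N) (P : OrderPoint N) :
    Finsupp.mapDomain (phi N) (delta N (eisensteinClass N P.1)) =
      (2 * (N : ℝ)) • (∑ μ : UnitsModSign N, orbitTerm P μ) -
        ((N : ℝ) / 2) • (∑ Q : CN N, Finsupp.single Q (1 : ℝ)) := by
  classical
  refine Finsupp.ext fun Q => ?_
  obtain ⟨g, rfl⟩ := exists_colClass Q
  have hones : (∑ Q : CN N, Finsupp.single Q (1 : ℝ)) (colClass N g) = 1 := by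
    simp [Finsupp.finsetSum_apply, Finsupp.single_apply]
  rw [mapDomain_delta_eisensteinClass, Finsupp.smul_apply, sum_fibre, Finsupp.sub_apply,
    Finsupp.smul_apply, Finsupp.smul_apply, hones, Finsupp.finsetSum_apply]
  simp only [coeffF_mul_T_pow, smul_eq_mul]
  by_cases hy : (g 0 0 : ZMod N) * P.1 1 - g 1 0 * P.1 0 = 0
  · obtain ⟨μ, hμ, hc⟩ := exists_unit_of_proportional P g hy
    rw [Finset.sum_eq_single (μ : UnitsModSign N)]
    · rw [orbitTerm_mk, hc, Finsupp.single_eq_same, hy, hμ]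
      simp
      ring
    · rintro ν - hν
      obtain ⟨ν, rfl⟩ := QuotientGroup.mk_surjective ν
      rw [orbitTerm_mk, Finsupp.single_apply, if_neg]
      intro h
      refine hν (QuotientGroup.eq.mpr ?_)
      rcases (coords_of_unitMul h).2 with h' | h'
      · obtain rfl : μ = ν := Units.ext (hμ.symm.trans h')
        simp
      · obtain rfl : μ = -ν := Units.ext (by simpa using hμ.symm.trans h')
        simp
    · simp
  · rw [sum_F_of_ne_zero hN _ _ hy, Finset.sum_eq_zero]
    · ring
    · rintro ν -
      obtain ⟨ν, rfl⟩ := QuotientGroup.mk_surjective ν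
      rw [orbitTerm_mk, Finsupp.single_apply, if_neg]
      exact fun h => hy (coords_of_unitMul h).1

end EisensteinCycle

theorem theorem13 (N : ℕ) [NeZero N] (hN : Odd N) (P : EisensteinCycle.OrderPoint N) :
    Function.Bijective (EisensteinCycle.phi N) ∧
    Finsupp.mapDomain (EisensteinCycle.phi N)
        (EisensteinCycle.delta N (EisensteinCycle.eisensteinClass N P.1)) =
      (2 * (N : ℝ)) • (∑ μ : EisensteinCycle.UnitsModSign N, EisensteinCycle.orbitTerm P μ) -
        ((N : ℝ) / 2) • (∑ Q : EisensteinCycle.CN N, Finsupp.single Q (1 : ℝ)) :=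
  ⟨EisensteinCycle.phi_bijective N,
    EisensteinCycle.mapDomain_delta_eisensteinClass_eq hN P⟩
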